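/- Conventions. All C*-algebras are unital and nonzero; $A\otimes B$ is the completed spatial (minimal) tensor product, with its C*-norm. Let $(X,d)$ be a metric space and let $\{A_x\}_{x\in X}$ be a family of C*-algebras. An operator field is a function $F$ on $X$ with $F(x)\in A_x$ for all $x$. For $f:X\to\mathbb{C}$ let $\tilde f$ be the scalar-valued operator field $\tilde f(x)=f(x)1_x$, and let $\tilde d$ be the scalar-valued metric operator field (mof) $\tilde d_{x,x'}=d(x,x')\,1_x\otimes 1_{x'}$. Put $$\|f\|_d=\sup_{x\ne x'}\frac{|f(x)-f(x')|}{d(x,x')},\qquad \|F\|_{\tilde d}=\sup_{x\neq x'}\big\|\tilde d_{x,x'}^{-1/2}\big(F(x)\otimes 1_{x'}-1_x\otimes F(x')\big)\tilde d_{x,x'}^{-1/2}\big\|,$$ $\|f\|_\infty=\sup_x|f(x)|$, $\|F\|_\infty=\sup_x\|F(x)\|$ (values in $[0,\infty]$). The field $F$ is called Lipschitz with respect to $\tilde d$ if $\|F\|_{\tilde d}<\infty$. Let $\mathbf{Lip}(d)$ be the *-algebra of functions $f$ with $\|f\|_d,\|f\|_\infty<\infty$, with norm $\|f\|_{\mathbf{Lip}}=\|f\|_d+\|f\|_\infty$,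 and let $\mathbf{Lip}(\tilde d)$ be the *-algebra of operator fields $F$ with $\|F\|_{\tilde d},\|F\|_\infty<\infty$ which commute with $\tilde d$ (i.e. $\tilde d_{x,x'}$ commutes with $F(x)\otimes1_{x'}$ for all $x,x'$), with norm $\|F\|_{\mathbf{Lip}}=\|F\|_{\tilde d}+\|F\|_\infty$; operations are pointwise. Theorem. Suppose that every point of $X$ is a limit point of $X$. Then $f\mapsto\tilde f$ is an isometric *-isomorphism from $(\mathbf{Lip}(d),\|\cdot\|_{\mathbf{Lip}})$ onto $(\mathbf{Lip}(\tilde d),\|\cdot\|_{\mathbf{Lip}})$. Moreover every operator field (bounded or not) that is Lipschitz with respect to $\tilde d$ is scalar-valued, i.e. of the form $\tilde f$ for some $f:X\to\mathbb{C}$. -/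

import Mathlib

open scoped TensorProduct ComplexOrder ENNReal NNReal

universe u v

noncomputable section

namespace MetricField

section SpatialTensor

variable {A B C : Type u} [CStarAlgebra A] [CStarAlgebra B] [CStarAlgebra C]

/-- A unital `*`-representation of a C*-algebra on a Hilbert space. -/
structure CStarRep (A : Type u) [CStarAlgebra A] : Type (u + 1) where
  space : Type u
  [normedAddCommGroup : NormedAddCommGroup space]
  [innerProductSpace : InnerProductSpace ℂ space]
  [completeSpace : CompleteSpace space]
  toHom : A →⋆ₐ[ℂ] (space →L[ℂ] space)

attribute [instance] CStarRep.normedAddCommGroup CStarRep.innerProductSpace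
  CStarRep.completeSpace

/-- The representation of `A` obtained from one of `B` along a `*`-homomorphism `A → B`. -/
def CStarRep.comap (ρ : CStarRep B) (f : A →⋆ₐ[ℂ] B) : CStarRep A where
  space := ρ.space
  toHom := ρ.toHom.comp f

/-- The representation `π ⊗ ρ` of the algebraic tensor product by bounded operators on the
(uncompleted) tensor product of the two Hilbert spaces: `a ⊗ b` acts as `π a ⊗ ρ b`. -/
def tensorRep (π : CStarRep A) (ρ : CStarRep B) :
    A ⊗[ℂ] B →ₐ[ℂ] (π.space ⊗[ℂ] ρ.space →L[ℂ] π.space ⊗[ℂ] ρ.space) :=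
  Algebra.TensorProduct.lift
    { toFun := fun a => (π.toHom a).rTensor ρ.space
      map_one' := by simp
      map_mul' := fun a b => by simp [ContinuousLinearMap.rTensor_mul]
      map_zero' := by simp
      map_add' := fun a b => by simp
      commutes' := fun r => by
        simp [Algebra.algebraMap_eq_smul_one] }
    { toFun := fun b => (ρ.toHom b).lTensor π.space
      map_one' := by simp
      map_mul' := fun a b => by simp [ContinuousLinearMap.lTensor_mul]
      map_zero' := by simp
      map_add' := fun a b => by simp
      commutes' := fun r => by
        simp [Algebra.algebraMap_eq_smul_one] }
    (fun a b => by
      change _ * _ = _ * _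
      ext x
      induction x with
      | zero => simp
      | tmul x y => simp
      | add x y hx hy => simp only [map_add, hx, hy])

theorem tensorRep_tmul_tmul (π : CStarRep A) (ρ : CStarRep B) (a : A) (b : B) (x : π.space)
    (y : ρ.space) : tensorRep π ρ (a ⊗ₜ b) (x ⊗ₜ y) = (π.toHom a x) ⊗ₜ (ρ.toHom b y) := by
  simp [tensorRep]

theorem inner_tensorRep_star (π : CStarRep A) (ρ : CStarRep B) (t : A ⊗[ℂ] B)
    (x y : π.space ⊗[ℂ] ρ.space) :
    inner ℂ (tensorRep π ρ (star t) x) y = inner ℂ x (tensorRep π ρ t y) := by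
  induction t with
  | zero => simp
  | add s t hs ht => simp [inner_add_left, inner_add_right, hs, ht]
  | tmul a b =>
    induction x with
    | zero => simp
    | add x x' hx hx' => simp only [map_add, inner_add_left, hx, hx']
    | tmul x₁ x₂ =>
      induction y with
      | zero => simp
      | add y y' hy hy' => simp only [map_add, inner_add_right, hy, hy']
      | tmul y₁ y₂ =>
        simp [tensorRep_tmul_tmul, map_star, ContinuousLinearMap.star_eq_adjoint,
          ContinuousLinearMap.adjoint_inner_left]

theorem norm_tensorRep_tmul_le (π : CStarRep A) (ρ : CStarRep B) (a : A) (b : B) :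
    ‖tensorRep π ρ (a ⊗ₜ b)‖ ≤ ‖a‖ * ‖b‖ := by
  have h : tensorRep π ρ (a ⊗ₜ b) = TensorProduct.mapL (π.toHom a) (ρ.toHom b) := by
    ext x
    induction x with
    | zero => simp
    | tmul x y => simp [tensorRep_tmul_tmul]
    | add x y hx hy => simp only [map_add, hx, hy]
  rw [h]
  refine (TensorProduct.norm_mapL_le _ _).trans ?_
  gcongr
  · exact NonUnitalStarAlgHom.norm_apply_le π.toHom a
  · exact NonUnitalStarAlgHom.norm_apply_le ρ.toHom b

theorem exists_norm_tensorRep_le (t : A ⊗[ℂ] B) :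
    ∃ M : ℝ, ∀ p : CStarRep A × CStarRep B, ‖tensorRep p.1 p.2 t‖ ≤ M := by
  induction t with
  | zero => exact ⟨0, fun p => by rw [map_zero]; exact ContinuousLinearMap.opNorm_zero.le⟩
  | tmul a b => exact ⟨‖a‖ * ‖b‖, fun p => norm_tensorRep_tmul_le p.1 p.2 a b⟩
  | add s t hs ht =>
    obtain ⟨M, hM⟩ := hs
    obtain ⟨N, hN⟩ := ht
    refine ⟨M + N, fun p => ?_⟩
    rw [map_add]
    exact (ContinuousLinearMap.opNorm_add_le _ _).trans (add_le_add (hM p) (hN p))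

/-- The spatial (minimal) C*-seminorm on the algebraic tensor product: the supremum of
`‖(π ⊗ ρ)(t)‖` over all representations `π` of `A` and `ρ` of `B`. -/
def spatialNorm (t : A ⊗[ℂ] B) : ℝ :=
  ⨆ p : CStarRep A × CStarRep B, ‖tensorRep p.1 p.2 t‖

theorem bddAbove_tensorRep (t : A ⊗[ℂ] B) :
    BddAbove (Set.range fun p : CStarRep A × CStarRep B => ‖tensorRep p.1 p.2 t‖) := by
  obtain ⟨M, hM⟩ := exists_norm_tensorRep_le t
  exact ⟨M, by rintro _ ⟨p, rfl⟩; exact hM p⟩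

theorem le_spatialNorm (π : CStarRep A) (ρ : CStarRep B) (t : A ⊗[ℂ] B) :
    ‖tensorRep π ρ t‖ ≤ spatialNorm t :=
  le_ciSup (bddAbove_tensorRep t) (π, ρ)

theorem spatialNorm_nonneg (t : A ⊗[ℂ] B) : 0 ≤ spatialNorm t :=
  Real.iSup_nonneg fun _ => ContinuousLinearMap.opNorm_nonneg _

theorem spatialNorm_le {t : A ⊗[ℂ] B} {M : ℝ} (hM : 0 ≤ M)
    (h : ∀ (π : CStarRep A) (ρ : CStarRep B), ‖tensorRep π ρ t‖ ≤ M) : spatialNorm t ≤ M :=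
  Real.iSup_le (fun p => h p.1 p.2) hM

theorem spatialNorm_star_mul_self (t : A ⊗[ℂ] B) :
    spatialNorm t * spatialNorm t ≤ spatialNorm (star t * t) := by
  have hs := spatialNorm_nonneg (star t * t)
  suffices h : spatialNorm t ≤ √(spatialNorm (star t * t)) by
    have := mul_self_le_mul_self (spatialNorm_nonneg t) h
    rwa [Real.mul_self_sqrt hs] at this
  refine spatialNorm_le (Real.sqrt_nonneg _) fun π ρ => ?_
  refine ContinuousLinearMap.opNorm_le_bound _ (Real.sqrt_nonneg _) fun x => ?_
  refine abs_le_of_sq_le_sq' ?_ (by positivity) |>.2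
  rw [mul_pow, Real.sq_sqrt hs]
  have h1 : ‖tensorRep π ρ t x‖ ^ 2 = (inner ℂ x (tensorRep π ρ (star t * t) x) : ℂ).re := by
    rw [map_mul, mul_apply_eq_comp, ← inner_tensorRep_star (t := star t), star_star]
    exact (inner_self_eq_norm_sq (𝕜 := ℂ) _).symm
  rw [h1]
  calc (inner ℂ x (tensorRep π ρ (star t * t) x) : ℂ).re
      ≤ ‖x‖ * ‖tensorRep π ρ (star t * t) x‖ :=
        re_inner_le_norm (𝕜 := ℂ) x (tensorRep π ρ (star t * t) x)
    _ ≤ ‖x‖ * (‖tensorRep π ρ (star t * t)‖ * ‖x‖) := by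
        gcongr; exact ContinuousLinearMap.le_opNorm _ _
    _ ≤ ‖x‖ * (spatialNorm (star t * t) * ‖x‖) := by
        gcongr; exact le_spatialNorm _ _ _
    _ = _ := by ring

theorem spatialNorm_smul_le (r : ℂ) (t : A ⊗[ℂ] B) :
    spatialNorm (r • t) ≤ ‖r‖ * spatialNorm t :=
  spatialNorm_le (mul_nonneg (norm_nonneg _) (spatialNorm_nonneg _)) fun π ρ => by
    rw [map_smul]
    refine (ContinuousLinearMap.opNorm_smul_le _ _).trans ?_
    gcongr
    exact le_spatialNorm _ _ _

theorem spatialNorm_zero : spatialNorm (0 : A ⊗[ℂ] B) = 0 :=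
  le_antisymm (by simpa using spatialNorm_smul_le 0 (0 : A ⊗[ℂ] B)) (spatialNorm_nonneg _)

theorem spatialNorm_neg (t : A ⊗[ℂ] B) : spatialNorm (-t) = spatialNorm t :=
  le_antisymm (by simpa using spatialNorm_smul_le (-1) t)
    (by simpa using spatialNorm_smul_le (-1) (-t))

theorem spatialNorm_add_le (s t : A ⊗[ℂ] B) :
    spatialNorm (s + t) ≤ spatialNorm s + spatialNorm t :=
  spatialNorm_le (add_nonneg (spatialNorm_nonneg _) (spatialNorm_nonneg _)) fun π ρ => by
    rw [map_add]
    exact (ContinuousLinearMap.opNorm_add_le _ _).trans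
      (add_le_add (le_spatialNorm _ _ _) (le_spatialNorm _ _ _))

theorem spatialNorm_mul_le (s t : A ⊗[ℂ] B) :
    spatialNorm (s * t) ≤ spatialNorm s * spatialNorm t :=
  spatialNorm_le (mul_nonneg (spatialNorm_nonneg _) (spatialNorm_nonneg _)) fun π ρ => by
    rw [map_mul]
    exact (ContinuousLinearMap.opNorm_comp_le _ _).trans
      (mul_le_mul (le_spatialNorm _ _ _) (le_spatialNorm _ _ _)
        (ContinuousLinearMap.opNorm_nonneg _) (spatialNorm_nonneg _))

/-- The algebraic tensor product of two C*-algebras, carrying the spatial seminorm. -/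
def AlgTensor (A B : Type u) [CStarAlgebra A] [CStarAlgebra B] : Type u := A ⊗[ℂ] B

instance : Ring (AlgTensor A B) := inferInstanceAs (Ring (A ⊗[ℂ] B))
instance : Algebra ℂ (AlgTensor A B) := inferInstanceAs (Algebra ℂ (A ⊗[ℂ] B))
instance : StarRing (AlgTensor A B) := inferInstanceAs (StarRing (A ⊗[ℂ] B))
instance : StarModule ℂ (AlgTensor A B) := inferInstanceAs (StarModule ℂ (A ⊗[ℂ] B))

/-- The spatial seminorm as a submultiplicative seminorm. -/
def spatialRingSeminorm (A B : Type u) [CStarAlgebra A] [CStarAlgebra B] :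
    RingSeminorm (AlgTensor A B) where
  toFun := spatialNorm (A := A) (B := B)
  map_zero' := spatialNorm_zero (A := A) (B := B)
  add_le' := spatialNorm_add_le (A := A) (B := B)
  neg' := spatialNorm_neg (A := A) (B := B)
  mul_le' := spatialNorm_mul_le (A := A) (B := B)

instance : SeminormedRing (AlgTensor A B) where
  __ := (inferInstance : Ring (AlgTensor A B))
  __ := (spatialRingSeminorm A B).toAddGroupSeminorm.toSeminormedAddCommGroup
  norm_mul_le := (spatialRingSeminorm A B).mul_le'

theorem AlgTensor.norm_def (t : AlgTensor A B) : ‖t‖ = spatialNorm (A := A) (B := B) t := rfl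

instance : NormedAlgebra ℂ (AlgTensor A B) where
  norm_smul_le := spatialNorm_smul_le (A := A) (B := B)

theorem AlgTensor.norm_star_mul_self (t : AlgTensor A B) : ‖t‖ * ‖t‖ ≤ ‖star t * t‖ :=
  spatialNorm_star_mul_self (A := A) (B := B) t

theorem AlgTensor.norm_star (t : AlgTensor A B) : ‖star t‖ = ‖t‖ := by
  have key : ∀ s : AlgTensor A B, ‖s‖ ≤ ‖star s‖ := fun s => by
    rcases (norm_nonneg s).eq_or_lt with h | h
    · rw [← h]; exact norm_nonneg _
    · exact le_of_mul_le_mul_right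
        ((AlgTensor.norm_star_mul_self s).trans (norm_mul_le _ _)) h
  exact le_antisymm (by simpa using key (star t)) (key t)

/-- The spatial tensor product of two (unital) C*-algebras: the completion of the algebraic
tensor product in the spatial norm. -/
def SpatialTensor (A B : Type u) [CStarAlgebra A] [CStarAlgebra B] : Type u :=
  UniformSpace.Completion (AlgTensor A B)

infixl:100 " ⊗ₛ " => SpatialTensor

instance : NormedRing (A ⊗ₛ B) :=
  inferInstanceAs (NormedRing (UniformSpace.Completion (AlgTensor A B)))
instance : CompleteSpace (A ⊗ₛ B) :=
  inferInstanceAs (CompleteSpace (UniformSpace.Completion (AlgTensor A B)))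

instance : NormedAlgebra ℂ (A ⊗ₛ B) where
  __ := (inferInstanceAs (Algebra ℂ (UniformSpace.Completion (AlgTensor A B))) :
    Algebra ℂ (A ⊗ₛ B))
  norm_smul_le := norm_smul_le (α := ℂ) (β := UniformSpace.Completion (AlgTensor A B))

/-- The canonical map of the algebraic tensor product into the spatial one. -/
def ofAlg (t : AlgTensor A B) : A ⊗ₛ B := (t : UniformSpace.Completion (AlgTensor A B))

theorem norm_ofAlg (t : AlgTensor A B) : ‖ofAlg t‖ = ‖t‖ := UniformSpace.Completion.norm_coe t

theorem denseRange_ofAlg : DenseRange (ofAlg : AlgTensor A B → A ⊗ₛ B) :=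
  UniformSpace.Completion.denseRange_coe

theorem continuous_ofAlg : Continuous (ofAlg : AlgTensor A B → A ⊗ₛ B) :=
  UniformSpace.Completion.continuous_coe _

theorem ofAlg_add (s t : AlgTensor A B) : ofAlg (s + t) = ofAlg s + ofAlg t :=
  UniformSpace.Completion.coe_add _ _
theorem ofAlg_mul (s t : AlgTensor A B) : ofAlg (s * t) = ofAlg s * ofAlg t :=
  UniformSpace.Completion.coe_mul _ _
theorem ofAlg_one : ofAlg (1 : AlgTensor A B) = 1 := rfl
theorem ofAlg_smul (r : ℂ) (t : AlgTensor A B) : ofAlg (r • t) = r • ofAlg t :=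
  UniformSpace.Completion.coe_smul _ _

theorem continuous_star_algTensor : UniformContinuous (star : AlgTensor A B → AlgTensor A B) :=
  (AddMonoidHomClass.isometry_of_norm (starAddEquiv : AlgTensor A B ≃+ AlgTensor A B)
    AlgTensor.norm_star).uniformContinuous

instance : Star (A ⊗ₛ B) where
  star := UniformSpace.Completion.map (star : AlgTensor A B → AlgTensor A B)

theorem star_ofAlg (t : AlgTensor A B) : star (ofAlg t) = ofAlg (star t) :=
  UniformSpace.Completion.map_coe continuous_star_algTensor t

theorem continuous_star_spatial : Continuous (star : A ⊗ₛ B → A ⊗ₛ B) :=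
  UniformSpace.Completion.continuous_map

@[elab_as_elim]
theorem spatial_induction {p : A ⊗ₛ B → Prop} (x : A ⊗ₛ B) (hc : IsClosed {x | p x})
    (h : ∀ t : AlgTensor A B, p (ofAlg t)) : p x :=
  UniformSpace.Completion.induction_on x hc h

@[elab_as_elim]
theorem spatial_induction₂ {p : A ⊗ₛ B → A ⊗ₛ B → Prop} (x y : A ⊗ₛ B)
    (hc : IsClosed {x : (A ⊗ₛ B) × (A ⊗ₛ B) | p x.1 x.2})
    (h : ∀ s t : AlgTensor A B, p (ofAlg s) (ofAlg t)) : p x y :=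
  UniformSpace.Completion.induction_on₂ x y hc h

instance : ContinuousStar (A ⊗ₛ B) := ⟨continuous_star_spatial⟩

instance : StarRing (A ⊗ₛ B) where
  star_involutive x := by
    induction x using spatial_induction with
    | hc => exact isClosed_eq (by fun_prop) (by fun_prop)
    | h t => rw [star_ofAlg, star_ofAlg, star_star]
  star_mul x y := by
    induction x, y using spatial_induction₂ with
    | hc => exact isClosed_eq (by fun_prop) (by fun_prop)
    | h s t => rw [← ofAlg_mul, star_ofAlg, star_ofAlg, star_ofAlg, star_mul, ofAlg_mul]
  star_add x y := by
    induction x, y using spatial_induction₂ with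
    | hc => exact isClosed_eq (by fun_prop) (by fun_prop)
    | h s t => rw [← ofAlg_add, star_ofAlg, star_ofAlg, star_ofAlg, star_add, ofAlg_add]

instance : StarModule ℂ (A ⊗ₛ B) where
  star_smul r x := by
    induction x using spatial_induction with
    | hc =>
      exact isClosed_eq (continuous_star_spatial.comp (continuous_const_smul r))
        ((continuous_const_smul (star r)).comp continuous_star_spatial)
    | h t => rw [← ofAlg_smul, star_ofAlg, star_ofAlg, star_smul, ofAlg_smul]

instance : CStarRing (A ⊗ₛ B) where
  norm_mul_self_le x := by
    induction x using spatial_induction with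
    | hc => exact isClosed_le (by fun_prop) (by fun_prop)
    | h t =>
      rw [star_ofAlg, ← ofAlg_mul, norm_ofAlg, norm_ofAlg]
      exact AlgTensor.norm_star_mul_self t

instance : CStarAlgebra (A ⊗ₛ B) where

/-- The usual order of a C*-algebra. -/
instance : PartialOrder (A ⊗ₛ B) := CStarAlgebra.spectralOrder _
instance : StarOrderedRing (A ⊗ₛ B) := CStarAlgebra.spectralOrderedRing _

/-- The elementary tensor `a ⊗ b` in the spatial tensor product. -/
def elem (a : A) (b : B) : A ⊗ₛ B := ofAlg (a ⊗ₜ[ℂ] b : A ⊗[ℂ] B)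

theorem elem_one_one : (elem 1 1 : A ⊗ₛ B) = 1 := rfl

theorem norm_elem_le (a : A) (b : B) : ‖(elem a b : A ⊗ₛ B)‖ ≤ ‖a‖ * ‖b‖ := by
  refine (norm_ofAlg _).trans_le ?_
  exact spatialNorm_le (by positivity) fun π ρ => norm_tensorRep_tmul_le π ρ a b

theorem elem_mul_elem (a a' : A) (b b' : B) :
    (elem a b : A ⊗ₛ B) * elem a' b' = elem (a * a') (b * b') :=
  (ofAlg_mul _ _).symm.trans
    (congrArg ofAlg (Algebra.TensorProduct.tmul_mul_tmul (R := ℂ) a a' b b'))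

theorem star_elem (a : A) (b : B) : star (elem a b : A ⊗ₛ B) = elem (star a) (star b) :=
  star_ofAlg _

/-- `a ↦ a ⊗ 1`. -/
def inclLeft : A →⋆ₐ[ℂ] A ⊗ₛ B where
  toFun a := elem a 1
  map_one' := elem_one_one
  map_mul' a a' := by rw [elem_mul_elem, mul_one]
  map_zero' := congrArg ofAlg (TensorProduct.zero_tmul A (1 : B))
  map_add' a a' := (congrArg ofAlg (TensorProduct.add_tmul (R := ℂ) a a' (1 : B))).trans
    (ofAlg_add _ _)
  commutes' r := by
    rw [Algebra.algebraMap_eq_smul_one, Algebra.algebraMap_eq_smul_one, ← elem_one_one]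
    exact (congrArg ofAlg (TensorProduct.smul_tmul' (R := ℂ) r (1 : A) (1 : B)).symm).trans
      (ofAlg_smul _ _)
  map_star' a := by rw [star_elem, star_one]

/-- `b ↦ 1 ⊗ b`. -/
def inclRight : B →⋆ₐ[ℂ] A ⊗ₛ B where
  toFun b := elem 1 b
  map_one' := elem_one_one
  map_mul' a a' := by rw [elem_mul_elem, mul_one]
  map_zero' := congrArg ofAlg (TensorProduct.tmul_zero B (1 : A))
  map_add' a a' := (congrArg ofAlg (TensorProduct.tmul_add (R := ℂ) (1 : A) a a')).trans
    (ofAlg_add _ _)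
  commutes' r := by
    rw [Algebra.algebraMap_eq_smul_one, Algebra.algebraMap_eq_smul_one, ← elem_one_one]
    exact (congrArg ofAlg (TensorProduct.tmul_smul (R := ℂ) r (1 : A) (1 : B))).trans
      (ofAlg_smul _ _)
  map_star' a := by rw [star_elem, star_one]

theorem inclLeft_apply (a : A) : (inclLeft a : A ⊗ₛ B) = elem a 1 := rfl
theorem inclRight_apply (b : B) : (inclRight b : A ⊗ₛ B) = elem 1 b := rfl

variable {A' B' : Type u} [CStarAlgebra A'] [CStarAlgebra B']

/-- Extension by continuity of a contractive `*`-homomorphism of algebraic tensor products. -/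
def extendHom (φ : AlgTensor A B →ₐ[ℂ] AlgTensor A' B') (hs : ∀ t, φ (star t) = star (φ t))
    (hn : ∀ t, ‖φ t‖ ≤ ‖t‖) : A ⊗ₛ B →⋆ₐ[ℂ] A' ⊗ₛ B' :=
  have huc : UniformContinuous φ :=
    (AddMonoidHomClass.lipschitz_of_bound φ 1 (by simpa using hn)).uniformContinuous
  have hc : Continuous (UniformSpace.Completion.map φ : A ⊗ₛ B → A' ⊗ₛ B') :=
    UniformSpace.Completion.continuous_map
  have hcoe : ∀ t : AlgTensor A B,
      (UniformSpace.Completion.map φ : A ⊗ₛ B → A' ⊗ₛ B') (ofAlg t) = ofAlg (φ t) :=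
    fun t => UniformSpace.Completion.map_coe huc t
  { toFun := (UniformSpace.Completion.map φ : A ⊗ₛ B → A' ⊗ₛ B')
    map_one' := by rw [← ofAlg_one, hcoe, map_one, ofAlg_one]
    map_zero' := (hcoe 0).trans (congrArg ofAlg (map_zero φ))
    map_mul' := fun x y => by
      induction x, y using spatial_induction₂ with
      | hc => exact isClosed_eq (by fun_prop) (by fun_prop)
      | h s t => rw [← ofAlg_mul, hcoe, hcoe, hcoe, map_mul, ofAlg_mul]
    map_add' := fun x y => by
      induction x, y using spatial_induction₂ with
      | hc => exact isClosed_eq (by fun_prop) (by fun_prop)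
      | h s t => rw [← ofAlg_add, hcoe, hcoe, hcoe, map_add, ofAlg_add]
    commutes' := fun r => by
      rw [Algebra.algebraMap_eq_smul_one, Algebra.algebraMap_eq_smul_one, ← ofAlg_one,
        ← ofAlg_smul, hcoe, map_smul, map_one, ofAlg_smul, ofAlg_one]
    map_star' := fun x => by
      induction x using spatial_induction with
      | hc =>
        refine isClosed_eq ?_ ?_
        · exact hc.comp continuous_star_spatial
        · exact continuous_star_spatial.comp hc
      | h t => rw [star_ofAlg, hcoe, hcoe, hs, star_ofAlg] }

theorem extendHom_ofAlg (φ : AlgTensor A B →ₐ[ℂ] AlgTensor A' B')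
    (hs : ∀ t, φ (star t) = star (φ t)) (hn : ∀ t, ‖φ t‖ ≤ ‖t‖) (t : AlgTensor A B) :
    extendHom φ hs hn (ofAlg t) = ofAlg (φ t) :=
  UniformSpace.Completion.map_coe
    (AddMonoidHomClass.lipschitz_of_bound φ 1 (by simpa using hn)).uniformContinuous t

theorem tensorRep_map (f : A →⋆ₐ[ℂ] A') (g : B →⋆ₐ[ℂ] B') (π : CStarRep A') (ρ : CStarRep B')
    (t : A ⊗[ℂ] B) :
    tensorRep π ρ (Algebra.TensorProduct.map f.toAlgHom g.toAlgHom t) =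
      tensorRep (π.comap f) (ρ.comap g) t := by
  induction t with
  | zero => rw [map_zero, map_zero, map_zero]; rfl
  | add s t hs ht => rw [map_add, map_add, map_add, hs, ht]; rfl
  | tmul a b =>
    rw [Algebra.TensorProduct.map_tmul]
    simp only [tensorRep, Algebra.TensorProduct.lift_tmul]
    rfl

theorem map_star_algTensor (f : A →⋆ₐ[ℂ] A') (g : B →⋆ₐ[ℂ] B') (t : A ⊗[ℂ] B) :
    Algebra.TensorProduct.map f.toAlgHom g.toAlgHom (star t) =
      star (Algebra.TensorProduct.map f.toAlgHom g.toAlgHom t) := by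
  induction t with
  | zero => simp
  | add s t hs ht => rw [star_add, map_add, hs, ht, map_add, star_add]
  | tmul a b => simp [map_star]

theorem spatialNorm_map_le (f : A →⋆ₐ[ℂ] A') (g : B →⋆ₐ[ℂ] B') (t : A ⊗[ℂ] B) :
    spatialNorm (Algebra.TensorProduct.map f.toAlgHom g.toAlgHom t) ≤ spatialNorm t :=
  spatialNorm_le (spatialNorm_nonneg _) fun π ρ => by
    rw [tensorRep_map]
    exact le_spatialNorm (π.comap f) (ρ.comap g) t

/-- The `*`-homomorphism `f ⊗ g` of spatial tensor products. -/
def spatialMap (f : A →⋆ₐ[ℂ] A') (g : B →⋆ₐ[ℂ] B') : A ⊗ₛ B →⋆ₐ[ℂ] A' ⊗ₛ B' :=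
  extendHom (Algebra.TensorProduct.map f.toAlgHom g.toAlgHom : A ⊗[ℂ] B →ₐ[ℂ] A' ⊗[ℂ] B')
    (map_star_algTensor f g) (spatialNorm_map_le f g)

theorem spatialMap_elem (f : A →⋆ₐ[ℂ] A') (g : B →⋆ₐ[ℂ] B') (a : A) (b : B) :
    spatialMap f g (elem a b) = elem (f a) (g b) :=
  extendHom_ofAlg _ _ _ _

theorem tensorRep_comm (π : CStarRep B) (ρ : CStarRep A) (t : A ⊗[ℂ] B)
    (x : ρ.space ⊗[ℂ] π.space) :
    tensorRep π ρ (Algebra.TensorProduct.comm ℂ A B t) (TensorProduct.comm ℂ ρ.space π.space x) =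
      TensorProduct.comm ℂ ρ.space π.space (tensorRep ρ π t x) := by
  induction t with
  | zero => simp
  | add s t hs ht => simp [hs, ht]
  | tmul a b =>
    induction x with
    | zero => simp
    | add x y hx hy => simp only [map_add, hx, hy]
    | tmul x y => simp [tensorRep_tmul_tmul]

theorem comm_star_algTensor (t : A ⊗[ℂ] B) :
    Algebra.TensorProduct.comm ℂ A B (star t) = star (Algebra.TensorProduct.comm ℂ A B t) := by
  induction t with
  | zero => simp
  | add s t hs ht => rw [star_add, map_add, hs, ht, map_add, star_add]
  | tmul a b => simp

theorem spatialNorm_comm_le (t : A ⊗[ℂ] B) :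
    spatialNorm (Algebra.TensorProduct.comm ℂ A B t) ≤ spatialNorm t :=
  spatialNorm_le (spatialNorm_nonneg _) fun π ρ => by
    refine ContinuousLinearMap.opNorm_le_bound _ (spatialNorm_nonneg _) fun y => ?_
    have h := tensorRep_comm π ρ t (TensorProduct.comm ℂ π.space ρ.space y)
    have hy : TensorProduct.comm ℂ ρ.space π.space (TensorProduct.comm ℂ π.space ρ.space y) = y :=
      (TensorProduct.comm ℂ π.space ρ.space).symm_apply_apply y
    rw [hy] at h
    rw [h, TensorProduct.norm_comm]
    refine (ContinuousLinearMap.le_opNorm _ _).trans ?_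
    rw [TensorProduct.norm_comm]
    gcongr
    exact le_spatialNorm ρ π t

/-- The flip `A ⊗ B → B ⊗ A`, `a ⊗ b ↦ b ⊗ a`. -/
def flip : A ⊗ₛ B →⋆ₐ[ℂ] B ⊗ₛ A :=
  extendHom (Algebra.TensorProduct.comm ℂ A B : A ⊗[ℂ] B →ₐ[ℂ] B ⊗[ℂ] A)
    comm_star_algTensor spatialNorm_comm_le

theorem flip_elem (a : A) (b : B) : flip (elem a b) = elem b a :=
  extendHom_ofAlg _ _ _ _

/-- The canonical `*`-homomorphism `A ⊗ C → A ⊗ B ⊗ C`, `a ⊗ c ↦ a ⊗ 1 ⊗ c`. -/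
def unitMiddle : A ⊗ₛ C →⋆ₐ[ℂ] A ⊗ₛ (B ⊗ₛ C) := spatialMap (StarAlgHom.id ℂ A) inclRight

/-- The canonical `*`-homomorphism `A ⊗ B → A ⊗ B ⊗ C`, `u ↦ u ⊗ 1`. -/
def unitLast : A ⊗ₛ B →⋆ₐ[ℂ] A ⊗ₛ (B ⊗ₛ C) := spatialMap (StarAlgHom.id ℂ A) inclLeft

/-- The canonical `*`-homomorphism `B ⊗ C → A ⊗ B ⊗ C`, `u ↦ 1 ⊗ u`. -/
def unitFirst : B ⊗ₛ C →⋆ₐ[ℂ] A ⊗ₛ (B ⊗ₛ C) := inclRight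

/-- A state of a unital C*-algebra: a positive linear functional of value one at the unit. -/
structure State (A : Type u) [CStarAlgebra A] extends A →ₗ[ℂ] ℂ where
  nonneg' : ∀ a : A, 0 ≤ toFun (star a * a)
  map_one' : toFun 1 = 1

theorem State.exists_gns (μ : State A) :
    ∃ (π : CStarRep A) (ξ : π.space), ‖ξ‖ = 1 ∧
      ∀ a, inner ℂ ξ (π.toHom a ξ) = μ.toLinearMap a := by
  let : PartialOrder A := CStarAlgebra.spectralOrder A
  let : StarOrderedRing A := CStarAlgebra.spectralOrderedRing A
  let f : A →ₚ[ℂ] ℂ := PositiveLinearMap.mk₀ μ.toLinearMap fun x hx => by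
    obtain ⟨b, rfl⟩ := CStarAlgebra.nonneg_iff_eq_star_mul_self.mp hx
    exact μ.nonneg' b
  have hf1 : f 1 = 1 := μ.map_one'
  refine ⟨⟨f.GNS, f.gnsStarAlgHom⟩, ((f.toPreGNS 1 : f.PreGNS) : f.GNS), ?_, fun a => ?_⟩
  · rw [UniformSpace.Completion.norm_coe, PositiveLinearMap.preGNS_norm_def]
    simp [hf1]
  · change inner ℂ ((f.toPreGNS 1 : f.PreGNS) : f.GNS)
      (f.gnsNonUnitalStarAlgHom a ((f.toPreGNS 1 : f.PreGNS) : f.GNS)) = f a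
    rw [PositiveLinearMap.gnsNonUnitalStarAlgHom_apply_coe,
      UniformSpace.Completion.inner_coe, PositiveLinearMap.preGNS_inner_def]
    simp

/-- The functional `a ⊗ b ↦ μ a * ν b` on the algebraic tensor product. -/
def algProd (μ : State A) (ν : State B) : A ⊗[ℂ] B →ₗ[ℂ] ℂ :=
  (TensorProduct.lid ℂ ℂ).toLinearMap ∘ₗ TensorProduct.map μ.toLinearMap ν.toLinearMap

theorem norm_algProd_le (μ : State A) (ν : State B) (t : A ⊗[ℂ] B) :
    ‖algProd μ ν t‖ ≤ spatialNorm t := by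
  obtain ⟨π, ξ, hξ, hπ⟩ := μ.exists_gns
  obtain ⟨ρ, η, hη, hρ⟩ := ν.exists_gns
  have h : algProd μ ν t = inner ℂ (ξ ⊗ₜ[ℂ] η) (tensorRep π ρ t (ξ ⊗ₜ[ℂ] η)) := by
    induction t with
    | zero => simp
    | add s t hs ht => rw [map_add, hs, ht, map_add, add_apply, inner_add_right]
    | tmul a b => simp [algProd, tensorRep_tmul_tmul, hπ, hρ]
  rw [h]
  calc _ ≤ ‖ξ ⊗ₜ[ℂ] η‖ * ‖tensorRep π ρ t (ξ ⊗ₜ[ℂ] η)‖ := norm_inner_le_norm _ _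
    _ ≤ ‖ξ ⊗ₜ[ℂ] η‖ * (‖tensorRep π ρ t‖ * ‖ξ ⊗ₜ[ℂ] η‖) := by
        gcongr; exact ContinuousLinearMap.le_opNorm _ _
    _ = ‖tensorRep π ρ t‖ := by simp [hξ, hη]
    _ ≤ spatialNorm t := le_spatialNorm π ρ t

/-- The product functional `μ ⊗ ν` on the spatial tensor product. -/
def prodState (μ : State A) (ν : State B) : A ⊗ₛ B →L[ℂ] ℂ :=
  ((algProd μ ν : AlgTensor A B →ₗ[ℂ] ℂ).mkContinuous 1 fun t => by
    rw [one_mul]; exact norm_algProd_le μ ν t).extend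
    (UniformSpace.Completion.toComplL (𝕜 := ℂ) (E := AlgTensor A B) :
      AlgTensor A B →L[ℂ] A ⊗ₛ B)

theorem prodState_elem (μ : State A) (ν : State B) (a : A) (b : B) :
    prodState μ ν (elem a b) = μ.toLinearMap a * ν.toLinearMap b :=
  (ContinuousLinearMap.extend_eq _ (UniformSpace.Completion.denseRange_coe)
    (UniformSpace.Completion.isUniformInducing_coe (AlgTensor A B)) _).trans
    (by change algProd μ ν (a ⊗ₜ[ℂ] b) = _; simp [algProd])

/-- Every nonzero unital C*-algebra has a state. -/
theorem exists_state (A : Type u) [CStarAlgebra A] [Nontrivial A] : Nonempty (State A) := by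
  let : PartialOrder A := CStarAlgebra.spectralOrder A
  let : StarOrderedRing A := CStarAlgebra.spectralOrderedRing A
  obtain ⟨g, hg, hg1⟩ := exists_dual_vector'' ℂ (1 : A)
  have hg1 : g 1 = 1 := by simpa using hg1
  have hle : ∀ a, ‖g a‖ ≤ ‖a‖ := fun a => (g.le_opNorm a).trans
    (mul_le_of_le_one_left (norm_nonneg _) hg)
  have him : ∀ h : A, IsSelfAdjoint h → (g h).im = 0 := by
    intro h hh
    have key : ∀ t : ℝ, (g h).re ^ 2 + ((g h).im + t) ^ 2 ≤ ‖h‖ ^ 2 + t ^ 2 := by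
      intro t
      have h1 : ‖g (h + ((t : ℂ) * Complex.I) • (1 : A))‖ ^ 2 =
          (g h).re ^ 2 + ((g h).im + t) ^ 2 := by
        rw [← Complex.normSq_eq_norm_sq, Complex.normSq_apply, map_add, map_smul, hg1]
        simp
        ring
      have h2 : star (h + ((t : ℂ) * Complex.I) • (1 : A)) * (h + ((t : ℂ) * Complex.I) • (1 : A))
          = h * h + ((t : ℂ) ^ 2) • (1 : A) := by
        rw [star_add, hh.star_eq, star_smul, star_one]
        have : star ((t : ℂ) * Complex.I) = -((t : ℂ) * Complex.I) := by simp
        rw [this]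
        rw [show ((t : ℂ) ^ 2) = -(((t : ℂ) * Complex.I) * ((t : ℂ) * Complex.I)) by
          linear_combination (t : ℂ) ^ 2 * Complex.I_mul_I]
        generalize (t : ℂ) * Complex.I = c
        simp only [add_mul, mul_add, smul_mul_assoc, mul_smul_comm, one_mul, mul_one, smul_add,
          smul_smul]
        module
      rw [← h1]
      calc _ ≤ ‖h + ((t : ℂ) * Complex.I) • (1 : A)‖ ^ 2 := by gcongr; exact hle _
        _ = ‖h * h + ((t : ℂ) ^ 2) • (1 : A)‖ := by
          rw [← h2, CStarRing.norm_star_mul_self, sq]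
        _ ≤ ‖h * h‖ + ‖((t : ℂ) ^ 2) • (1 : A)‖ := norm_add_le _ _
        _ ≤ ‖h‖ ^ 2 + t ^ 2 := by
          rw [norm_smul]
          have := norm_mul_le h h
          simp
          nlinarith
    by_contra hne
    have := key ((‖h‖ ^ 2 + 1) / (g h).im)
    have h3 : (g h).im * ((‖h‖ ^ 2 + 1) / (g h).im) = ‖h‖ ^ 2 + 1 := by field_simp
    nlinarith [sq_nonneg (g h).re, sq_nonneg (g h).im, sq_nonneg ‖h‖]
  refine ⟨{ toLinearMap := g.toLinearMap, nonneg' := fun a => ?_, map_one' := hg1 }⟩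
  change 0 ≤ g (star a * a)
  set b := star a * a with hb
  have hb0 : 0 ≤ b := star_mul_self_nonneg a
  have hbs : IsSelfAdjoint b := .of_nonneg hb0
  have hre : 0 ≤ (g b).re := by
    have h1 : b ≤ algebraMap ℝ A ‖b‖ := hbs.le_algebraMap_norm_self
    have h2 : ‖algebraMap ℝ A ‖b‖ - b‖ ≤ ‖b‖ := by
      have := CStarAlgebra.norm_le_norm_of_nonneg_of_le (sub_nonneg.mpr h1)
        (sub_le_self (algebraMap ℝ A ‖b‖) hb0)
      simpa using this
    have h3 : g (algebraMap ℝ A ‖b‖ - b) = (‖b‖ : ℂ) - g b := by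
      rw [map_sub, IsScalarTower.algebraMap_apply ℝ ℂ A, Algebra.algebraMap_eq_smul_one (A := A),
        map_smul, hg1]
      simp
    have h4 := (Complex.re_le_norm _).trans ((hle _).trans h2)
    rw [h3] at h4
    simp at h4
    exact h4
  exact Complex.nonneg_iff.mpr ⟨hre, (him b hbs).symm⟩

end SpatialTensor

/-! ### Lipschitz functions on an ordinary metric space -/

section Scalar

variable {X : Type v}

theorem enorm_star_eq {B : Type*} [NormedAddCommGroup B] [StarAddMonoid B] [NormedStarGroup B]
    (b : B) : ‖star b‖ₑ = ‖b‖ₑ := by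
  simp only [enorm_eq_nnnorm, nnnorm_star]

/-- `‖f‖_∞ = sup_x |f x|`, with values in `[0, ∞]`. -/
def supNorm (f : X → ℂ) : ℝ≥0∞ := ⨆ x, ‖f x‖ₑ

theorem le_supNorm (f : X → ℂ) (x : X) : ‖f x‖ₑ ≤ supNorm f := le_iSup (fun x => ‖f x‖ₑ) x

variable [MetricSpace X]

/-- `‖f‖_d = sup_{x ≠ x'} |f x - f x'| / d x x'`, with values in `[0, ∞]`. -/
def lipConst (f : X → ℂ) : ℝ≥0∞ :=
  ⨆ (x : X) (x' : X) (_ : x ≠ x'), ‖f x - f x'‖ₑ / ENNReal.ofReal (dist x x')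

/-- `‖f‖_Lip = ‖f‖_d + ‖f‖_∞`, with values in `[0, ∞]`. -/
def lipNorm (f : X → ℂ) : ℝ≥0∞ := lipConst f + supNorm f

theorem le_lipConst (f : X → ℂ) {x x' : X} (h : x ≠ x') :
    ‖f x - f x'‖ₑ / ENNReal.ofReal (dist x x') ≤ lipConst f :=
  le_iSup_of_le x (le_iSup_of_le x' (le_iSup_of_le h le_rfl))

theorem lipConst_le {f : X → ℂ} {M : ℝ≥0∞}
    (h : ∀ x x', x ≠ x' → ‖f x - f x'‖ₑ / ENNReal.ofReal (dist x x') ≤ M) : lipConst f ≤ M :=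
  iSup_le fun x => iSup_le fun x' => iSup_le fun hx => h x x' hx

variable (X) in
/-- The `*`-algebra of bounded complex-valued Lipschitz functions on a metric space, with
pointwise operations. -/
def LipAlg : StarSubalgebra ℂ (X → ℂ) where
  carrier := {f | supNorm f < ∞ ∧ lipConst f < ∞}
  mul_mem' := by
    rintro f g ⟨hf, hf'⟩ ⟨hg, hg'⟩
    refine ⟨lt_of_le_of_lt (iSup_le fun x => ?_) (ENNReal.mul_lt_top hf hg),
      lt_of_le_of_lt (lipConst_le fun x x' hx => ?_)
        (ENNReal.add_lt_top.mpr ⟨ENNReal.mul_lt_top hf hg', ENNReal.mul_lt_top hf' hg⟩)⟩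
    · rw [Pi.mul_apply, enorm_mul]
      exact mul_le_mul' (le_supNorm f x) (le_supNorm g x)
    · have h : (f * g) x - (f * g) x' = f x * (g x - g x') + (f x - f x') * g x' := by
        simp only [Pi.mul_apply]; ring
      rw [h]
      refine (ENNReal.div_le_div_right (enorm_add_le _ _) _).trans ?_
      rw [ENNReal.add_div, enorm_mul, enorm_mul, mul_div_assoc, mul_comm (‖f x - f x'‖ₑ),
        mul_div_assoc, mul_comm (‖g x'‖ₑ)]
      gcongr
      · exact le_supNorm f x
      · exact le_lipConst g hx
      · exact le_lipConst f hx
      · exact le_supNorm g x'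
  add_mem' := by
    rintro f g ⟨hf, hf'⟩ ⟨hg, hg'⟩
    refine ⟨lt_of_le_of_lt (iSup_le fun x => ?_) (ENNReal.add_lt_top.mpr ⟨hf, hg⟩),
      lt_of_le_of_lt (lipConst_le fun x x' hx => ?_) (ENNReal.add_lt_top.mpr ⟨hf', hg'⟩)⟩
    · exact (enorm_add_le _ _).trans (add_le_add (le_supNorm f x) (le_supNorm g x))
    · have h : (f + g) x - (f + g) x' = (f x - f x') + (g x - g x') := by
        simp only [Pi.add_apply]; ring
      rw [h]
      refine (ENNReal.div_le_div_right (enorm_add_le _ _) _).trans ?_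
      rw [ENNReal.add_div]
      exact add_le_add (le_lipConst f hx) (le_lipConst g hx)
  algebraMap_mem' r := by
    refine ⟨lt_of_le_of_lt (iSup_le fun x => ?_) (enorm_lt_top (x := r)),
      lt_of_le_of_lt (lipConst_le fun x x' hx => ?_) ENNReal.zero_lt_top⟩
    · simp
    · simp
  star_mem' := by
    rintro f ⟨hf, hf'⟩
    refine ⟨lt_of_le_of_lt (iSup_le fun x => ?_) hf,
      lt_of_le_of_lt (lipConst_le fun x x' hx => ?_) hf'⟩
    · simpa using le_supNorm f x
    · rw [Pi.star_apply, Pi.star_apply, ← star_sub, enorm_star_eq]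
      exact le_lipConst f hx

end Scalar

/-! ### Metric operator fields and Lipschitz operator fields -/

section Field

variable {X : Type v}

/-- A metric operator field (mof) on a bundle `A` of C*-algebras over a set `X`. -/
structure MetricOperatorField (A : X → Type u) [∀ x, CStarAlgebra (A x)] where
  toFun : ∀ x x', A x ⊗ₛ A x'
  /-- There are states `μ x` of `A x` (metric-states) with `(μ x ⊗ μ x) (D x x) = 0`. -/
  exists_metricStates' : ∃ μ : ∀ x, State (A x), ∀ x, prodState (μ x) (μ x) (toFun x x) = 0
  nonneg' : ∀ x x', x ≠ x' → 0 ≤ toFun x x'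
  isUnit' : ∀ x x', x ≠ x' → IsUnit (toFun x x')
  symm' : ∀ x x', toFun x x' = flip (toFun x' x)
  /-- The order in the triangle inequality is that of self-adjoint elements, so that the values
  of `D` (also the diagonal ones) are self-adjoint. -/
  isSelfAdjoint' : ∀ x x', IsSelfAdjoint (toFun x x')
  /-- The triangle inequality, in `A x ⊗ A x' ⊗ A x''`. -/
  triangle' : ∀ x x' x'', (unitMiddle (toFun x x'') : A x ⊗ₛ (A x' ⊗ₛ A x'')) ≤
    unitLast (toFun x x') + unitFirst (toFun x' x'')

instance (A : X → Type u) [∀ x, CStarAlgebra (A x)] :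
    CoeFun (MetricOperatorField A) fun _ => ∀ x x', A x ⊗ₛ A x' := ⟨MetricOperatorField.toFun⟩

/-- The scalar-valued operator field `f̃ : x ↦ f x • 1` of a complex-valued function `f`. -/
def scalarField (A : X → Type u) [∀ x, CStarAlgebra (A x)] (f : X → ℂ) : ∀ x, A x :=
  fun x => f x • (1 : A x)

theorem real_smul_one_nonneg {A B : Type u} [CStarAlgebra A] [CStarAlgebra B] {r : ℝ}
    (hr : 0 ≤ r) : 0 ≤ (r : ℂ) • (elem 1 1 : A ⊗ₛ B) := by
  have h : (r : ℂ) • (elem 1 1 : A ⊗ₛ B) =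
      star (((√r : ℝ) : ℂ) • (1 : A ⊗ₛ B)) * (((√r : ℝ) : ℂ) • (1 : A ⊗ₛ B)) := by
    rw [elem_one_one, star_smul, star_one, smul_mul_smul_comm, one_mul]
    congr 1
    simp [← Complex.ofReal_mul, Real.mul_self_sqrt hr]
  rw [h]
  exact star_mul_self_nonneg _

/-- The scalar-valued mof `d̃ : (x, x') ↦ d x x' • (1 ⊗ 1)` of an ordinary metric `d`. -/
def scalarMof [MetricSpace X] (A : X → Type u) [∀ x, CStarAlgebra (A x)]
    [∀ x, Nontrivial (A x)] : MetricOperatorField A where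
  toFun x x' := ((dist x x' : ℝ) : ℂ) • elem 1 1
  exists_metricStates' := ⟨fun x => (exists_state (A x)).some, fun x => by simp⟩
  nonneg' x x' _ := real_smul_one_nonneg dist_nonneg
  isUnit' x x' h := by
    rw [elem_one_one, ← Algebra.algebraMap_eq_smul_one]
    exact (IsUnit.mk0 _ (by simpa using h)).map (algebraMap ℂ _)
  symm' x x' := by rw [map_smul, flip_elem, dist_comm]
  isSelfAdjoint' x x' := .of_nonneg (real_smul_one_nonneg dist_nonneg)
  triangle' x x' x'' := by
    rw [map_smul, map_smul, map_smul, elem_one_one, elem_one_one, elem_one_one, map_one, map_one,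
      map_one, ← add_smul, ← sub_nonneg, ← sub_smul]
    have := real_smul_one_nonneg (A := A x) (B := A x' ⊗ₛ A x'')
      (sub_nonneg.mpr (dist_triangle x x' x''))
    simpa [elem_one_one] using this

variable {A : X → Type u} [∀ x, CStarAlgebra (A x)]

/-- `‖F‖_∞ = sup_x ‖F x‖`, with values in `[0, ∞]`. -/
def fieldSupNorm (F : ∀ x, A x) : ℝ≥0∞ := ⨆ x, ‖F x‖ₑ

namespace MetricOperatorField

variable (D : MetricOperatorField A)

/-- `D_{x,x'}^{-1/2} (F x ⊗ 1 - 1 ⊗ F x') D_{x,x'}^{-1/2}`. -/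
def deLeeuw (F : ∀ x, A x) (x x' : X) : A x ⊗ₛ A x' :=
  CFC.rpow (D x x') (-(1 / 2)) * (elem (F x) 1 - elem 1 (F x')) * CFC.rpow (D x x') (-(1 / 2))

/-- `‖F‖_D = sup_{x ≠ x'} ‖D_{x,x'}^{-1/2} (F x ⊗ 1 - 1 ⊗ F x') D_{x,x'}^{-1/2}‖`, with values in
`[0, ∞]`. -/
def lipConst (F : ∀ x, A x) : ℝ≥0∞ := ⨆ (x : X) (x' : X) (_ : x ≠ x'), ‖D.deLeeuw F x x'‖ₑ

/-- An operator field is Lipschitz with respect to `D` if `‖F‖_D < ∞`. -/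
def IsLipschitz (F : ∀ x, A x) : Prop := D.lipConst F < ∞

/-- `‖F‖_Lip = ‖F‖_∞ + ‖F‖_D`, with values in `[0, ∞]`. -/
def lipNorm (F : ∀ x, A x) : ℝ≥0∞ := fieldSupNorm F + D.lipConst F

/-- The operator field `F` commutes with `D`. -/
def Commutes (F : ∀ x, A x) : Prop := ∀ x x', Commute (D x x') (elem (F x) 1)

variable {D}

theorem le_lipConst (F : ∀ x, A x) {x x' : X} (h : x ≠ x') : ‖D.deLeeuw F x x'‖ₑ ≤ D.lipConst F :=
  le_iSup_of_le x (le_iSup_of_le x' (le_iSup_of_le h le_rfl))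

theorem lipConst_le {F : ∀ x, A x} {M : ℝ≥0∞} (h : ∀ x x', x ≠ x' → ‖D.deLeeuw F x x'‖ₑ ≤ M) :
    D.lipConst F ≤ M :=
  iSup_le fun x => iSup_le fun x' => iSup_le fun hx => h x x' hx

theorem le_fieldSupNorm (F : ∀ x, A x) (x : X) : ‖F x‖ₑ ≤ fieldSupNorm F :=
  le_iSup (fun x => ‖F x‖ₑ) x

theorem Commutes.right {F : ∀ x, A x} (h : D.Commutes F) (x x' : X) :
    Commute (D x x') (elem 1 (F x')) := by
  have := (h x' x).map (flip : A x' ⊗ₛ A x →⋆ₐ[ℂ] A x ⊗ₛ A x')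
  rwa [flip_elem, ← D.symm'] at this

theorem elem_left_mul {B C : Type u} [CStarAlgebra B] [CStarAlgebra C] (a b : B) :
    (elem (a * b) 1 : B ⊗ₛ C) = elem a 1 * elem b 1 := map_mul inclLeft a b

theorem elem_right_mul {B C : Type u} [CStarAlgebra B] [CStarAlgebra C] (a b : C) :
    (elem 1 (a * b) : B ⊗ₛ C) = elem 1 a * elem 1 b := map_mul inclRight a b

theorem deLeeuw_mul {F G : ∀ x, A x} (hF : D.Commutes F) (hG : D.Commutes G) (x x' : X) :
    D.deLeeuw (F * G) x x' =
      elem (F x) 1 * D.deLeeuw G x x' + D.deLeeuw F x x' * elem 1 (G x') := by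
  have h1 : Commute (CFC.rpow (D x x') (-(1 / 2))) (elem (F x) 1) := (hF x x').cfc_nnreal _
  have h2 : Commute (CFC.rpow (D x x') (-(1 / 2))) (elem 1 (G x')) := (hG.right x x').cfc_nnreal _
  unfold deLeeuw
  rw [Pi.mul_apply, Pi.mul_apply, elem_left_mul, elem_right_mul]
  generalize CFC.rpow (D x x') (-(1 / 2)) = T at *
  simp only [mul_sub, sub_mul, ← mul_assoc]
  rw [← h1.eq, mul_assoc _ T (elem 1 (G x')), mul_assoc _ T (elem 1 (G x')), h2.eq]
  simp only [← mul_assoc]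
  abel

theorem deLeeuw_add (F G : ∀ x, A x) (x x' : X) :
    D.deLeeuw (F + G) x x' = D.deLeeuw F x x' + D.deLeeuw G x x' := by
  have h1 : (elem (F x + G x) 1 : A x ⊗ₛ A x') = elem (F x) 1 + elem (G x) 1 :=
    map_add inclLeft _ _
  have h2 : (elem 1 (F x' + G x') : A x ⊗ₛ A x') = elem 1 (F x') + elem 1 (G x') :=
    map_add inclRight _ _
  unfold deLeeuw
  rw [Pi.add_apply, Pi.add_apply, h1, h2, ← add_mul, ← mul_add]
  congr 2
  abel

theorem deLeeuw_star (F : ∀ x, A x) (x x' : X) :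
    D.deLeeuw (star F) x x' = star (D.deLeeuw F x x') := by
  have hT : star (CFC.rpow (D x x') (-(1 / 2))) = CFC.rpow (D x x') (-(1 / 2)) :=
    (IsSelfAdjoint.of_nonneg CFC.rpow_nonneg).star_eq
  unfold deLeeuw
  rw [star_mul, star_mul, hT, star_sub, star_elem, star_elem, star_one, star_one, mul_assoc]
  rfl

theorem deLeeuw_algebraMap (r : ℂ) (x x' : X) :
    D.deLeeuw (algebraMap ℂ (∀ x, A x) r) x x' = 0 := by
  have h1 : (elem (algebraMap ℂ (A x) r) 1 : A x ⊗ₛ A x') = algebraMap ℂ _ r :=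
    AlgHomClass.commutes inclLeft r
  have h2 : (elem 1 (algebraMap ℂ (A x') r) : A x ⊗ₛ A x') = algebraMap ℂ _ r :=
    AlgHomClass.commutes inclRight r
  unfold deLeeuw
  rw [Pi.algebraMap_apply, Pi.algebraMap_apply, h1, h2, sub_self, mul_zero, zero_mul]

theorem enorm_elem_left_le {B C : Type u} [CStarAlgebra B] [CStarAlgebra C] (b : B) :
    ‖(elem b 1 : B ⊗ₛ C)‖ₑ ≤ ‖b‖ₑ :=
  enorm_le_iff_norm_le.mpr (NonUnitalStarAlgHom.norm_apply_le (inclLeft : B →⋆ₐ[ℂ] B ⊗ₛ C) b)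

theorem enorm_elem_right_le {B C : Type u} [CStarAlgebra B] [CStarAlgebra C] (c : C) :
    ‖(elem 1 c : B ⊗ₛ C)‖ₑ ≤ ‖c‖ₑ :=
  enorm_le_iff_norm_le.mpr (NonUnitalStarAlgHom.norm_apply_le (inclRight : C →⋆ₐ[ℂ] B ⊗ₛ C) c)

theorem enorm_mul_le_mul {B : Type u} [CStarAlgebra B] (a b : B) :
    ‖a * b‖ₑ ≤ ‖a‖ₑ * ‖b‖ₑ := by
  simp only [enorm_eq_nnnorm]
  exact_mod_cast nnnorm_mul_le a b

variable (D) in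
/-- The Lipschitz algebra `Lip(D)`: the bounded operator fields that are Lipschitz with respect
to `D` and commute with `D`, with pointwise operations. -/
def LipAlg : StarSubalgebra ℂ (∀ x, A x) where
  carrier := {F | fieldSupNorm F < ∞ ∧ D.IsLipschitz F ∧ D.Commutes F}
  mul_mem' := by
    rintro F G ⟨hF, hF', hFD⟩ ⟨hG, hG', hGD⟩
    refine ⟨lt_of_le_of_lt (iSup_le fun x => ?_) (ENNReal.mul_lt_top hF hG),
      lt_of_le_of_lt (lipConst_le fun x x' hx => ?_)
        (ENNReal.add_lt_top.mpr ⟨ENNReal.mul_lt_top hF hG', ENNReal.mul_lt_top hF' hG⟩),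
      fun x x' => ?_⟩
    · exact (enorm_mul_le_mul _ _).trans
        (mul_le_mul' (le_fieldSupNorm F x) (le_fieldSupNorm G x))
    · rw [deLeeuw_mul hFD hGD]
      refine (enorm_add_le _ _).trans (add_le_add ?_ ?_)
      · exact (enorm_mul_le_mul _ _).trans (mul_le_mul'
          ((enorm_elem_left_le _).trans (le_fieldSupNorm F x)) (le_lipConst G hx))
      · exact (enorm_mul_le_mul _ _).trans (mul_le_mul' (le_lipConst F hx)
          ((enorm_elem_right_le _).trans (le_fieldSupNorm G x')))
    · rw [Pi.mul_apply, elem_left_mul]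
      exact (hFD x x').mul_right (hGD x x')
  add_mem' := by
    rintro F G ⟨hF, hF', hFD⟩ ⟨hG, hG', hGD⟩
    refine ⟨lt_of_le_of_lt (iSup_le fun x => ?_) (ENNReal.add_lt_top.mpr ⟨hF, hG⟩),
      lt_of_le_of_lt (lipConst_le fun x x' hx => ?_) (ENNReal.add_lt_top.mpr ⟨hF', hG'⟩),
      fun x x' => ?_⟩
    · exact (enorm_add_le _ _).trans (add_le_add (le_fieldSupNorm F x) (le_fieldSupNorm G x))
    · rw [deLeeuw_add]
      exact (enorm_add_le _ _).trans (add_le_add (le_lipConst F hx) (le_lipConst G hx))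
    · have h1 : (elem (F x + G x) 1 : A x ⊗ₛ A x') = elem (F x) 1 + elem (G x) 1 :=
        map_add inclLeft _ _
      rw [Pi.add_apply, h1]
      exact (hFD x x').add_right (hGD x x')
  algebraMap_mem' r := by
    refine ⟨lt_of_le_of_lt (iSup_le fun x => ?_) (enorm_lt_top (x := r)),
      lt_of_le_of_lt (lipConst_le fun x x' hx => ?_) ENNReal.zero_lt_top, fun x x' => ?_⟩
    · rw [enorm_le_iff_norm_le, Pi.algebraMap_apply, norm_algebraMap]
      have : ‖(1 : A x)‖ ≤ 1 := by
        cases subsingleton_or_nontrivial (A x)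
        · simp [Subsingleton.elim (1 : A x) 0]
        · simp
      exact mul_le_of_le_one_right (norm_nonneg _) this
    · simp [deLeeuw_algebraMap]
    · have h1 : (elem (algebraMap ℂ (A x) r) 1 : A x ⊗ₛ A x') = algebraMap ℂ _ r :=
        AlgHomClass.commutes inclLeft r
      rw [Pi.algebraMap_apply, h1]
      exact Algebra.commute_algebraMap_right r _
  star_mem' := by
    rintro F ⟨hF, hF', hFD⟩
    refine ⟨lt_of_le_of_lt (iSup_le fun x => ?_) hF,
      lt_of_le_of_lt (lipConst_le fun x x' hx => ?_) hF', fun x x' => ?_⟩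
    · rw [Pi.star_apply, enorm_star_eq]
      exact le_fieldSupNorm F x
    · rw [deLeeuw_star, enorm_star_eq]
      exact le_lipConst F hx
    · have h := (hFD x x').star_star
      rwa [(D.isSelfAdjoint' x x').star_eq, star_elem, star_one] at h

end MetricOperatorField

end Field

end MetricField

end

/-! For the scalar mof the quantity under the supremum is `d(x,x')⁻¹ (F(x) ⊗ 1 - 1 ⊗ F(x'))`. On a
scalar field this is a scalar multiple of `1 ⊗ 1`, which has norm one, so the operator norms of `f̃`
are the classical norms of `f`. Commutation with scalars is automatic. Everything therefore rests on
showing that a Lipschitz field is scalar-valued.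

Let `L = ‖F‖`. A product state `μ ⊗ ν` is contractive on the spatial tensor product and sends `F(x)
⊗ 1 - 1 ⊗ F(x')` to `μ(F(x)) - ν(F(x'))`. Hence `|μ(F(x)) - ν(F(x'))| ≤ L d(x,x')` for every pair of
states (`norm_apply_sub_apply_le`), with no relation required between `μ` and `ν`. Two states of `A
x` can thus both be compared with one state of `A y`, where `y ≠ x` is close to `x`. Their values at
`F(x)` differ by at most `2 L d(x,y)`, which is arbitrarily small at a limit point
(`state_apply_eq_of_isLipschitz`). Since states separate points, an element on which all states
agree is a multiple of the unit (`exists_eq_smul_one_of_forall_state_eq`).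

Separation of points comes from Hahn-Banach: a functional norming `1 + k`, with `k ≥ 0`, is a state
norming `k`. -/

namespace MetricField

/-! ### States of a C*-algebra: norming positive elements and separating points. -/

section States

variable {A B : Type u} [CStarAlgebra A] [CStarAlgebra B]

/-- Since `‖h + it‖² ≤ ‖h‖² + t²` for real `t`, contractivity bounds `|g(h) + it|²` by the same
quantity. The left side contains the cross term `2 t Im g(h)`, which is unbounded in `t` unless `Im
g(h) = 0`. -/
theorem im_eq_zero_of_isSelfAdjoint {g : StrongDual ℂ A} (hg : ‖g‖ ≤ 1) (hg1 : g 1 = 1) {h : A}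
    (hh : IsSelfAdjoint h) : (g h).im = 0 := by
  have key : ∀ t : ℝ, (g h).re ^ 2 + ((g h).im + t) ^ 2 ≤ ‖h‖ ^ 2 + t ^ 2 := by
    intro t
    have h1 : ‖g (h + ((t : ℂ) * Complex.I) • (1 : A))‖ ^ 2 =
        (g h).re ^ 2 + ((g h).im + t) ^ 2 := by
      rw [← Complex.normSq_eq_norm_sq, Complex.normSq_apply, map_add, map_smul, hg1]
      simp
      ring
    have h2 : star (h + ((t : ℂ) * Complex.I) • (1 : A)) * (h + ((t : ℂ) * Complex.I) • (1 : A))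
        = h * h + ((t : ℂ) ^ 2) • (1 : A) := by
      have h3 : star ((t : ℂ) * Complex.I) = -((t : ℂ) * Complex.I) := by simp
      rw [star_add, hh.star_eq, star_smul, star_one, h3,
        show ((t : ℂ) ^ 2) = -(((t : ℂ) * Complex.I) * ((t : ℂ) * Complex.I)) by
          linear_combination (t : ℂ) ^ 2 * Complex.I_mul_I]
      generalize (t : ℂ) * Complex.I = c
      simp only [add_mul, mul_add, smul_mul_assoc, mul_smul_comm, one_mul, mul_one, smul_add,
        smul_smul]
      module
    have h4 : ‖(1 : A)‖ ≤ 1 := by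
      cases subsingleton_or_nontrivial A
      · simp [Subsingleton.elim (1 : A) 0]
      · simp
    rw [← h1]
    calc _ ≤ ‖h + ((t : ℂ) * Complex.I) • (1 : A)‖ ^ 2 := by
            gcongr
            exact (g.le_opNorm _).trans (mul_le_of_le_one_left (norm_nonneg _) hg)
      _ = ‖h * h + ((t : ℂ) ^ 2) • (1 : A)‖ := by
        rw [← h2, CStarRing.norm_star_mul_self, sq]
      _ ≤ ‖h * h‖ + ‖((t : ℂ) ^ 2) • (1 : A)‖ := norm_add_le _ _
      _ ≤ ‖h‖ ^ 2 + t ^ 2 := by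
        rw [norm_smul, sq ‖h‖]
        refine add_le_add (norm_mul_le h h) ?_
        simpa using mul_le_of_le_one_right (sq_nonneg t) h4
  by_contra hne
  -- This `t` makes the cross term `2 t Im g(h)` equal to `2 (‖h‖² + 1)`, more than the `‖h‖²`
  -- available.
  have := key ((‖h‖ ^ 2 + 1) / (g h).im)
  have h3 : (g h).im * ((‖h‖ ^ 2 + 1) / (g h).im) = ‖h‖ ^ 2 + 1 := by field_simp
  nlinarith [sq_nonneg (g h).re, sq_nonneg (g h).im, sq_nonneg ‖h‖]

/-- A contractive functional with value one at the unit is a state. -/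
def State.ofContractive (g : StrongDual ℂ A) (hg : ‖g‖ ≤ 1) (hg1 : g 1 = 1) : State A where
  toLinearMap := g.toLinearMap
  map_one' := hg1
  nonneg' a := by
    let : PartialOrder A := CStarAlgebra.spectralOrder A
    let : StarOrderedRing A := CStarAlgebra.spectralOrderedRing A
    change 0 ≤ g (star a * a)
    set b := star a * a with hb
    have hb0 : 0 ≤ b := star_mul_self_nonneg a
    have hbs : IsSelfAdjoint b := .of_nonneg hb0
    have h1 : b ≤ algebraMap ℝ A ‖b‖ := hbs.le_algebraMap_norm_self
    -- From `0 ≤ ‖b‖ - b ≤ ‖b‖`, contractivity gives `|‖b‖ - g(b)| ≤ ‖b‖`, which forces `Re g(b) ≥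
    -- 0`.
    have h2 : ‖algebraMap ℝ A ‖b‖ - b‖ ≤ ‖b‖ := by
      refine (CStarAlgebra.norm_le_norm_of_nonneg_of_le (sub_nonneg.mpr h1)
        (sub_le_self (algebraMap ℝ A ‖b‖) hb0)).trans ?_
      cases subsingleton_or_nontrivial A
      · simp [Subsingleton.elim (algebraMap ℝ A ‖b‖) 0]
      · simp
    have h3 : g (algebraMap ℝ A ‖b‖ - b) = (‖b‖ : ℂ) - g b := by
      rw [map_sub, IsScalarTower.algebraMap_apply ℝ ℂ A, Algebra.algebraMap_eq_smul_one (A := A),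
        map_smul, hg1]
      simp
    have h4 := (Complex.re_le_norm _).trans
      (((g.le_opNorm _).trans (mul_le_of_le_one_left (norm_nonneg _) hg)).trans h2)
    rw [h3] at h4
    simp only [Complex.sub_re, Complex.ofReal_re, sub_le_self_iff] at h4
    exact Complex.nonneg_iff.mpr ⟨h4, (im_eq_zero_of_isSelfAdjoint hg hg1 hbs).symm⟩

theorem State.apply_one (μ : State A) : μ.toLinearMap 1 = 1 := μ.map_one'

/-- A state is only assumed positive; that it is hermitian is read off its GNS vector, where `star
a` acts as the adjoint. -/
theorem State.apply_star (μ : State A) (a : A) :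
    μ.toLinearMap (star a) = star (μ.toLinearMap a) := by
  obtain ⟨π, ξ, -, h⟩ := μ.exists_gns
  rw [← h, ← h, map_star, ContinuousLinearMap.star_eq_adjoint,
    ContinuousLinearMap.adjoint_inner_right]
  exact (inner_conj_symm (𝕜 := ℂ) _ _).symm

theorem State.apply_algebraMap (μ : State A) (r : ℝ) :
    μ.toLinearMap (algebraMap ℝ A r) = r := by
  rw [IsScalarTower.algebraMap_apply ℝ ℂ A, Algebra.algebraMap_eq_smul_one (A := A), map_smul,
    μ.apply_one]
  simp

/-- The norm of a positive element is attained at a state. -/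
theorem exists_state_apply_eq_norm [Nontrivial A] [PartialOrder A] [StarOrderedRing A] {k : A}
    (hk : 0 ≤ k) : ∃ μ : State A, μ.toLinearMap k = ‖k‖ := by
  -- The norm of a positive element lies in its spectrum, and adding the unit shifts the spectrum by
  -- one.
  have hn : 1 + ‖k‖ ≤ ‖1 + k‖ := by
    have h1 := spectrum.add_mem_add_iff (R := ℝ) (s := (1 : ℝ)) |>.mpr
      (CStarAlgebra.norm_mem_spectrum_of_nonneg hk)
    have h2 := spectrum.norm_le_norm_of_mem h1
    rwa [map_one, Real.norm_of_nonneg (by positivity), add_comm] at h2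
  obtain ⟨g, hg, hgk⟩ := exists_dual_vector'' ℂ (1 + k)
  have hle : ∀ a, ‖g a‖ ≤ ‖a‖ := fun a =>
    (g.le_opNorm a).trans (mul_le_of_le_one_left (norm_nonneg _) hg)
  -- Here `Re g(1) ≤ |g(1)| ≤ 1` and `Re g(k) ≤ |g(k)| ≤ ‖k‖`, while the real parts add up to at
  -- least `1 + ‖k‖`. All these inequalities are equalities, so `g(1) = 1` and `g(k) = ‖k‖`.
  have hre : (g 1).re + (g k).re = ‖1 + k‖ := by
    rw [← Complex.add_re, ← map_add, hgk]; simp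
  have h1 := (Complex.re_le_norm _).trans (hle 1)
  have h2 := (Complex.re_le_norm _).trans (hle k)
  rw [norm_one] at h1
  have e1 : (g 1).re = ‖g 1‖ := by
    have := hle 1
    have := Complex.re_le_norm (g 1)
    rw [norm_one] at *
    linarith
  have e2 : (g k).re = ‖g k‖ := by
    have := hle k
    have := Complex.re_le_norm (g k)
    linarith
  have hg1 : g 1 = 1 := by
    rw [Complex.re_eq_norm, Complex.nonneg_iff] at e1
    exact Complex.ext (by rw [Complex.one_re]; linarith) e1.2.symm
  refine ⟨.ofContractive g hg hg1, ?_⟩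
  change g k = _
  rw [Complex.re_eq_norm, Complex.nonneg_iff] at e2
  exact Complex.ext (by rw [Complex.ofReal_re]; linarith) e2.2.symm

/-- Take a state norming the positive element `k = ‖h‖ + h`. It vanishes on `h`, so `‖k‖ = ‖h‖`;
then `k ≤ ‖h‖`, that is, `h ≤ 0`. The same argument for `-h` gives the other inequality. -/
theorem eq_zero_of_isSelfAdjoint_of_forall_state [Nontrivial A] {h : A} (hh : IsSelfAdjoint h)
    (h0 : ∀ μ : State A, μ.toLinearMap h = 0) : h = 0 := by
  let : PartialOrder A := CStarAlgebra.spectralOrder A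
  let : StarOrderedRing A := CStarAlgebra.spectralOrderedRing A
  have key : ∀ h : A, IsSelfAdjoint h → (∀ μ : State A, μ.toLinearMap h = 0) → h ≤ 0 := by
    intro h hh h0
    have hk : 0 ≤ algebraMap ℝ A ‖h‖ + h := by
      simpa [neg_le_iff_add_nonneg'] using hh.neg_algebraMap_norm_le_self
    obtain ⟨μ, hμ⟩ := exists_state_apply_eq_norm hk
    rw [map_add, h0, μ.apply_algebraMap, add_zero, Complex.ofReal_inj] at hμ
    have := (IsSelfAdjoint.of_nonneg hk).le_algebraMap_norm_self
    rw [← hμ] at this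
    simpa using this
  refine le_antisymm (key h hh h0) ?_
  simpa using key (-h) hh.neg fun μ => by simp [h0]

/-- The states of a C*-algebra separate its points. -/
theorem eq_zero_of_forall_state [Nontrivial A] {a : A}
    (h0 : ∀ μ : State A, μ.toLinearMap a = 0) : a = 0 := by
  have hstar : ∀ μ : State A, μ.toLinearMap (star a) = 0 := fun μ => by
    rw [μ.apply_star, h0, star_zero]
  -- Both `a + a*` and `i (a - a*)` are self-adjoint and killed by every state, so `a* = -a` and `a*
  -- = a`.
  have h1 : a + star a = 0 :=
    eq_zero_of_isSelfAdjoint_of_forall_state (.add_star_self a) fun μ => by simp [h0, hstar]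
  have h2 : Complex.I • (a - star a) = 0 := by
    refine eq_zero_of_isSelfAdjoint_of_forall_state ?_ fun μ => by simp [h0, hstar]
    rw [IsSelfAdjoint, star_smul, star_sub, star_star, Complex.star_def, Complex.conj_I,
      neg_smul, ← smul_neg, neg_sub]
  have h3 : a = star a := sub_eq_zero.mp ((smul_eq_zero.mp h2).resolve_left Complex.I_ne_zero)
  rw [← h3, ← two_smul ℂ] at h1
  exact (smul_eq_zero.mp h1).resolve_left two_ne_zero

/-- If `c` is the common value of the states at `a`, every state kills `a - c • 1`. -/
theorem exists_eq_smul_one_of_forall_state_eq [Nontrivial A] {a : A}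
    (h : ∀ μ ν : State A, μ.toLinearMap a = ν.toLinearMap a) : ∃ c : ℂ, a = c • 1 := by
  obtain ⟨ν⟩ := exists_state A
  refine ⟨ν.toLinearMap a, sub_eq_zero.mp (eq_zero_of_forall_state fun μ => ?_)⟩
  rw [map_sub, map_smul, μ.apply_one, h μ ν]
  simp

/-! ### Product states on the spatial tensor product. -/

/-- The bound holds on the algebraic tensor product through the GNS representations and passes to
the completion by density. It turns norm estimates in `A ⊗ₛ B` into estimates on values of states.
-/
theorem norm_prodState_apply_le (μ : State A) (ν : State B) (x : A ⊗ₛ B) :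
    ‖prodState μ ν x‖ ≤ ‖x‖ := by
  induction x using spatial_induction with
  | hc => exact isClosed_le (by fun_prop) (by fun_prop)
  | h t =>
    have h : prodState μ ν (ofAlg t) = algProd μ ν t :=
      ContinuousLinearMap.extend_eq _ (UniformSpace.Completion.denseRange_coe)
        (UniformSpace.Completion.isUniformInducing_coe (AlgTensor A B)) t
    rw [h, norm_ofAlg]
    exact norm_algProd_le μ ν t

theorem prodState_elem_sub (μ : State A) (ν : State B) (a : A) (b : B) :
    prodState μ ν (elem a 1 - elem 1 b) = μ.toLinearMap a - ν.toLinearMap b := by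
  rw [map_sub, prodState_elem, prodState_elem, μ.apply_one, ν.apply_one, mul_one, one_mul]

/-- A product state takes the value one at the unit. This gives `‖1 ⊗ 1‖ = 1`, on which the isometry
depends. -/
instance [Nontrivial A] [Nontrivial B] : Nontrivial (A ⊗ₛ B) := by
  obtain ⟨μ⟩ := exists_state A
  obtain ⟨ν⟩ := exists_state B
  refine ⟨1, 0, fun h => ?_⟩
  have h1 := prodState_elem μ ν 1 1
  rw [elem_one_one, h, map_zero, μ.apply_one, ν.apply_one, one_mul] at h1
  exact zero_ne_one h1

theorem elem_smul_one_left (c : ℂ) : (elem (c • 1) 1 : A ⊗ₛ B) = c • 1 :=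
  (map_smul inclLeft c 1).trans (congrArg (c • ·) (map_one inclLeft))

theorem elem_smul_one_right (c : ℂ) : (elem 1 (c • 1) : A ⊗ₛ B) = c • 1 :=
  (map_smul inclRight c 1).trans (congrArg (c • ·) (map_one inclRight))

end States

/-! ### Scalar-valued operator fields. -/

section ScalarField

variable {X : Type v} {A : X → Type u} [∀ x, CStarAlgebra (A x)]

variable (A) in
/-- `f ↦ f̃` as a `*`-homomorphism from functions to operator fields. -/
def scalarFieldHom : (X → ℂ) →⋆ₐ[ℂ] (∀ x, A x) where
  toFun := scalarField A
  map_one' := funext fun _ => one_smul ℂ _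
  map_mul' f g := funext fun x => by simp [scalarField, smul_smul, mul_comm]
  map_zero' := funext fun _ => zero_smul ℂ _
  map_add' f g := funext fun _ => add_smul _ _ _
  commutes' r := funext fun _ => (Algebra.algebraMap_eq_smul_one r).symm
  map_star' f := funext fun x => by simp [scalarField]

variable [∀ x, Nontrivial (A x)]

theorem fieldSupNorm_scalarField (f : X → ℂ) : fieldSupNorm (scalarField A f) = supNorm f :=
  iSup_congr fun x => by
    rw [scalarField, ← ofReal_norm, norm_smul, norm_one, mul_one, ofReal_norm]

theorem scalarField_injective : Function.Injective (scalarField A) := fun _ _ h =>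
  funext fun x => smul_left_injective ℂ (one_ne_zero (α := A x)) (congrFun h x)

end ScalarField

/-! ### The scalar mof and its Lipschitz norm on scalar fields. -/

section ScalarMof

variable {X : Type v} [MetricSpace X] {A : X → Type u} [∀ x, CStarAlgebra (A x)]
  [∀ x, Nontrivial (A x)]

theorem rpow_scalarMof {x x' : X} (r : ℝ) :
    CFC.rpow (scalarMof A x x') r = ((dist x x' ^ r : ℝ) : ℂ) • 1 := by
  -- `CFC.rpow` is built on the functional calculus over `ℝ≥0`, so the distance enters as `nndist`
  -- and is translated to a complex scalar afterwards.
  have h := CFC.rpow_algebraMap (A := A x ⊗ₛ A x') (x := nndist x x') (y := r)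
  have e : ∀ s : ℝ≥0, algebraMap ℝ≥0 (A x ⊗ₛ A x') s = ((s : ℝ) : ℂ) • 1 := fun s => by
    rw [Algebra.algebraMap_eq_smul_one, NNReal.smul_def, Complex.coe_smul]
  rw [e, e, NNReal.coe_rpow, coe_nndist] at h
  exact h

theorem deLeeuw_scalarMof (F : ∀ x, A x) (x x' : X) :
    (scalarMof A).deLeeuw F x x' =
      (((dist x x')⁻¹ : ℝ) : ℂ) • (elem (F x) 1 - elem 1 (F x')) := by
  rw [MetricOperatorField.deLeeuw, rpow_scalarMof, smul_mul_assoc, one_mul, smul_mul_smul_comm,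
    mul_one, ← Complex.ofReal_mul]
  congr 2
  -- The exponents add up to `-1 ≠ 0`, so the power law also holds for base zero and `x = x'` needs
  -- no separate treatment.
  rw [← Real.rpow_add' dist_nonneg (by norm_num), ← Real.rpow_neg_one]
  norm_num

theorem enorm_deLeeuw_scalarField (f : X → ℂ) {x x' : X} (h : x ≠ x') :
    ‖(scalarMof A).deLeeuw (scalarField A f) x x'‖ₑ =
      ‖f x - f x'‖ₑ / ENNReal.ofReal (dist x x') := by
  have hd : 0 < dist x x' := dist_pos.mpr h
  rw [deLeeuw_scalarMof, scalarField, scalarField, elem_smul_one_left, elem_smul_one_right, ← sub_smul,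
    ← ofReal_norm, norm_smul, norm_smul, norm_one, mul_one, Complex.norm_real,
    Real.norm_of_nonneg (by positivity), inv_mul_eq_div, ENNReal.ofReal_div_of_pos hd, ofReal_norm]

theorem lipConst_scalarField (f : X → ℂ) :
    (scalarMof A).lipConst (scalarField A f) = lipConst f :=
  iSup_congr fun _ => iSup_congr fun _ => iSup_congr fun h => enorm_deLeeuw_scalarField f h

theorem lipNorm_scalarField (f : X → ℂ) :
    (scalarMof A).lipNorm (scalarField A f) = lipNorm f := by
  rw [MetricOperatorField.lipNorm, lipConst_scalarField, fieldSupNorm_scalarField, add_comm,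
    lipNorm]

theorem commutes_scalarMof (F : ∀ x, A x) : (scalarMof A).Commutes F := fun _ _ =>
  (Commute.one_left _).smul_left _

theorem scalarField_mem_lipAlg_iff (f : X → ℂ) :
    scalarField A f ∈ (scalarMof A).LipAlg ↔ f ∈ LipAlg X := by
  change fieldSupNorm _ < ∞ ∧ _ < ∞ ∧ _ ↔ supNorm f < ∞ ∧ lipConst f < ∞
  rw [fieldSupNorm_scalarField, lipConst_scalarField]
  exact and_congr_right' (and_iff_left (commutes_scalarMof _))

variable (A) in
/-- `f ↦ f̃` as a `*`-homomorphism of Lipschitz algebras. -/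
noncomputable def lipAlgHom : LipAlg X →⋆ₐ[ℂ] (scalarMof A).LipAlg :=
  ((scalarFieldHom A).comp (LipAlg X).subtype).codRestrict _
    fun f => (scalarField_mem_lipAlg_iff _).mpr f.2

/-! ### Lipschitz fields are scalar at limit points. -/

theorem norm_apply_sub_apply_le {F : ∀ x, A x} (hF : (scalarMof A).IsLipschitz F) {x x' : X}
    (h : x ≠ x') (μ : State (A x)) (ν : State (A x')) :
    ‖μ.toLinearMap (F x) - ν.toLinearMap (F x')‖ ≤
      ((scalarMof A).lipConst F).toReal * dist x x' := by
  have hd : 0 < dist x x' := dist_pos.mpr h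
  have h1 : ‖(scalarMof A).deLeeuw F x x'‖ ≤ ((scalarMof A).lipConst F).toReal := by
    rw [← toReal_enorm]
    -- Finiteness is essential here: `ENNReal.toReal` sends `∞` to `0`.
    exact ENNReal.toReal_mono hF.ne (MetricOperatorField.le_lipConst F h)
  rw [deLeeuw_scalarMof, norm_smul, Complex.norm_real, Real.norm_of_nonneg (by positivity),
    inv_mul_le_iff₀ hd, mul_comm] at h1
  rw [← prodState_elem_sub]
  exact (norm_prodState_apply_le _ _ _).trans h1

/-- Both states are compared with the same state `τ` of the algebra at a nearby point `y`, and the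
value of `τ` cancels. -/
theorem state_apply_eq_of_isLipschitz {F : ∀ x, A x} (hF : (scalarMof A).IsLipschitz F) {x : X}
    (hx : AccPt x (Filter.principal Set.univ)) (μ ν : State (A x)) :
    μ.toLinearMap (F x) = ν.toLinearMap (F x) := by
  set L := ((scalarMof A).lipConst F).toReal
  have hL : 0 ≤ L := ENNReal.toReal_nonneg
  refine sub_eq_zero.mp (norm_le_zero_iff.mp (le_of_forall_pos_le_add fun ε hε => ?_))
  -- Two comparisons cost `2 L d(x,y)`; the extra `1` keeps the radius meaningful when `L = 0`. That
  -- `x` is a limit point supplies `y ≠ x`, as the estimate is available only off the diagonal.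
  have hδ : 0 < ε / (2 * L + 1) := by positivity
  obtain ⟨y, ⟨hy, -⟩, hyx⟩ := accPt_iff_nhds.mp hx _ (Metric.ball_mem_nhds x hδ)
  obtain ⟨τ⟩ := exists_state (A y)
  have h1 := norm_apply_sub_apply_le hF hyx.symm μ τ
  have h2 := norm_apply_sub_apply_le hF hyx.symm ν τ
  rw [Metric.mem_ball, dist_comm, lt_div_iff₀ (by positivity)] at hy
  have h3 := norm_sub_le (μ.toLinearMap (F x) - τ.toLinearMap (F y))
    (ν.toLinearMap (F x) - τ.toLinearMap (F y))
  rw [sub_sub_sub_cancel_right] at h3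
  nlinarith [dist_nonneg (x := x) (y := y)]

theorem exists_eq_scalarField_of_isLipschitz (hX : ∀ x : X, AccPt x (Filter.principal Set.univ))
    {F : ∀ x, A x} (hF : (scalarMof A).IsLipschitz F) : ∃ f : X → ℂ, F = scalarField A f := by
  choose f hf using fun x =>
    exists_eq_smul_one_of_forall_state_eq (state_apply_eq_of_isLipschitz hF (hX x))
  exact ⟨f, funext hf⟩

/-- For surjectivity, a Lipschitz field is some `f̃`, and the equality of the norms of `f̃` and `f`
puts `f` in the scalar Lipschitz algebra. -/
theorem lipAlgHom_bijective (hX : ∀ x : X, AccPt x (Filter.principal Set.univ)) :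
    Function.Bijective (lipAlgHom A) := by
  refine ⟨fun f g h => Subtype.ext (scalarField_injective (congrArg Subtype.val h)),
    fun ⟨F, hF⟩ => ?_⟩
  obtain ⟨f, rfl⟩ := exists_eq_scalarField_of_isLipschitz hX hF.2.1
  exact ⟨⟨f, (scalarField_mem_lipAlg_iff f).mp hF⟩, rfl⟩

end ScalarMof

end MetricField

theorem mainTheorem9 {X : Type v} [MetricSpace X]
    (hX : ∀ x : X, AccPt x (Filter.principal Set.univ))
    (A : X → Type u) [∀ x, CStarAlgebra (A x)] [∀ x, Nontrivial (A x)] :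
    (∃ Φ : MetricField.LipAlg X ≃⋆ₐ[ℂ] (MetricField.scalarMof A).LipAlg,
      (∀ f : MetricField.LipAlg X,
        (Φ f : ∀ x, A x) = MetricField.scalarField A (f : X → ℂ)) ∧
      (∀ f : MetricField.LipAlg X,
        (MetricField.scalarMof A).lipNorm (Φ f : ∀ x, A x) =
          MetricField.lipNorm (f : X → ℂ))) ∧
    (∀ F : ∀ x, A x, (MetricField.scalarMof A).IsLipschitz F →
      ∃ f : X → ℂ, F = MetricField.scalarField A f) := by
  exact ⟨⟨.ofBijective (MetricField.lipAlgHom A) (MetricField.lipAlgHom_bijective hX),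
    fun _ => rfl, fun f => MetricField.lipNorm_scalarField (f : X → ℂ)⟩,
    fun _ => MetricField.exists_eq_scalarField_of_isLipschitz hX⟩
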